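/- Let $t_0\le t_f$, $\kappa\in\mathbb R$ and $\eta=\cos^2\kappa$ (the quantum efficiency). Let $a(t),b(t)$, $t\in[t_0,t_f]$, be the annihilation operators of two bosonic fields with $[a(t),a^\dagger(t')]=[b(t),b^\dagger(t')]=\delta(t-t')$ and $a(t),a^\dagger(t)$ commuting with $b(t'),b^\dagger(t')$, acting on $\mathcal H_A\otimes\mathcal H_B$, where $\mathcal H_A,\mathcal H_B$ are the bosonic Fock spaces over $L^2([t_0,t_f])$. Let $|\psi\rangle\in\mathcal H_A$ be a unit vector, $|0\rangle_B$ the vacuum of $\mathcal H_B$, $|\Psi\rangle=|\psi\rangle\otimes|0\rangle_B$, and $\langle I(t)\rangle=\langle\psi|a^\dagger(t)a(t)|\psi\rangle$ the mean photon flux. For measurable real functions $\phi,\theta$ put, with $\int dt=\int_{t_0}^{t_f}dt$, $$U_A=e^{\,i\int dt\,\phi(t)a^\dagger(t)a(t)},\qquad U_B=e^{\,i\int dt\,\theta(t)b^\dagger(t)b(t)},\qquad U_{AB}=e^{\,i\kappa\int dt\,[a^\dagger(t)b(t)+a(t)b^\dagger(t)]},$$ $$F[\phi(t)]=\bigl|\langle\Psi|U_{AB}^\dagger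 U_B^\dagger U_AU_{AB}|\Psi\rangle\bigr|^2,\qquad z(t)=\eta e^{i\phi(t)}+(1-\eta)e^{-i\theta(t)}.$$ Suppose that at every time $t\in[t_0,t_f]$ one of the following conditions holds: (I) $\eta<\tfrac12$; (II) $\eta\ge\tfrac12$, $|\sin\phi(t)|\le(1-\eta)/\eta$ and $\cos\phi(t)>0$. Then there is a measurable $\theta$ for which $z(t)$ is real and positive for all $t\in[t_0,t_f]$, and for every such $\theta$ $$F[\phi(t)]\ \ge\ F_z[\phi(t)]\equiv\exp\Bigl[\int_{t_0}^{t_f}dt\,\langle I(t)\rangle\ln z^2(t)\Bigr].$$ Here the integrand is nowhere positive, and the integral is taken in $[-\infty,0]$, with $0\cdot\infty=0$ and $\exp(-\infty)=0$. -/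

import Mathlib

open MeasureTheory
open scoped ENNReal

noncomputable section

namespace LossyPhase

/-! Two one-dimensional bosonic fields `a(t)`, `b(t)` in the time domain, with
`[a(t), a†(t')] = [b(t), b†(t')] = δ(t - t')`, in the Fock representation. -/

/-- A vector of the Fock space `H_A` of a single field, through its `n`-photon wave functions
`ψ n (t₁, …, tₙ)`. -/
abbrev Field : Type := ∀ n : ℕ, (Fin n → ℝ) → ℂ

/-- A vector of `H_A ⊗ H_B`, through its wave functions `Ψ n m (s; u)` with `n` photons
at the times `s` in the field `A` and `m` photons at the times `u` in the field `B`. -/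
abbrev TwoField : Type := ∀ n m : ℕ, (Fin n → ℝ) → (Fin m → ℝ) → ℂ

/-- Lebesgue measure on `[t₀, t₁]ⁿ`. -/
def timeMeasure (t₀ t₁ : ℝ) (n : ℕ) : Measure (Fin n → ℝ) :=
  Measure.pi fun _ => volume.restrict (Set.Icc t₀ t₁)

/-- `ψ` is a normalized vector of the bosonic Fock space over `L²([t₀, t₁])`. -/
structure IsState (t₀ t₁ : ℝ) (ψ : Field) : Prop where
  measurable : ∀ n, Measurable (ψ n)
  symmetric : ∀ (n : ℕ) (σ : Equiv.Perm (Fin n)) (t : Fin n → ℝ), ψ n (t ∘ σ) = ψ n t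
  norm_eq_one : ∑' n, ∫⁻ t, ‖ψ n t‖ₑ ^ 2 ∂(timeMeasure t₀ t₁ n) = 1

/-- The vector `|ψ⟩_A ⊗ |0⟩_B`. -/
def tensorVacuum (ψ : Field) : TwoField := fun n m s _ => if m = 0 then ψ n s else 0

/-- The inner product of `H_A ⊗ H_B`, conjugate-linear in the first argument. -/
def braket (t₀ t₁ : ℝ) (Φ Ψ : TwoField) : ℂ :=
  ∑' p : ℕ × ℕ, ∫ x : (Fin p.1 → ℝ) × (Fin p.2 → ℝ),
    (starRingEnd ℂ) (Φ p.1 p.2 x.1 x.2) * Ψ p.1 p.2 x.1 x.2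
      ∂((timeMeasure t₀ t₁ p.1).prod (timeMeasure t₀ t₁ p.2))

/-- The squared norm of `H_A ⊗ H_B`, infinite for functions that are not square-integrable. -/
def normSq (t₀ t₁ : ℝ) (Ψ : TwoField) : ℝ≥0∞ :=
  ∑' p : ℕ × ℕ, ∫⁻ x : (Fin p.1 → ℝ) × (Fin p.2 → ℝ), ‖Ψ p.1 p.2 x.1 x.2‖ₑ ^ 2
      ∂((timeMeasure t₀ t₁ p.1).prod (timeMeasure t₀ t₁ p.2))

/-- The annihilation operator `a(t)`: `(a(t)Ψ)ₙ(s) = √(n+1) Ψₙ₊₁(t, s)`. -/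
def annA (t : ℝ) (Ψ : TwoField) : TwoField := fun n m s u =>
  (Real.sqrt (n + 1) : ℂ) * Ψ (n + 1) m (Fin.cons t s) u

/-- The annihilation operator `b(t)`. -/
def annB (t : ℝ) (Ψ : TwoField) : TwoField := fun n m s u =>
  (Real.sqrt (m + 1) : ℂ) * Ψ n (m + 1) s (Fin.cons t u)

/-- The vector `∫ dt a†(t) Φ(t)`. Since
`(a†(t)Φ)ₙ₊₁(s) = (n+1)^(-1/2) ∑ₖ δ(t - sₖ) Φₙ(s without sₖ)`,
the integral over `t` replaces `t` by `sₖ`. -/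
def createA (Φ : ℝ → TwoField) : TwoField
  | 0, _, _, _ => 0
  | n + 1, m, s, u =>
    (Real.sqrt (n + 1) : ℂ)⁻¹ * ∑ k : Fin (n + 1), Φ (s k) n m (k.removeNth s) u

/-- The vector `∫ dt b†(t) Φ(t)`. -/
def createB (Φ : ℝ → TwoField) : TwoField
  | _, 0, _, _ => 0
  | n, m + 1, s, u =>
    (Real.sqrt (m + 1) : ℂ)⁻¹ * ∑ k : Fin (m + 1), Φ (u k) n m s (k.removeNth u)

/-- `∫ dt φ(t) a†(t) a(t)`. -/
def genA (φ : ℝ → ℝ) (Ψ : TwoField) : TwoField := createA fun t => (φ t : ℂ) • annA t Ψ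

/-- `∫ dt θ(t) b†(t) b(t)`. -/
def genB (θ : ℝ → ℝ) (Ψ : TwoField) : TwoField := createB fun t => (θ t : ℂ) • annB t Ψ

/-- `κ ∫ dt [a†(t) b(t) + a(t) b†(t)]`. -/
def genAB (κ : ℝ) (Ψ : TwoField) : TwoField :=
  (κ : ℂ) • (createA (fun t => annB t Ψ) + createB (fun t => annA t Ψ))

/-- `exp(iG) Ψ`, by the exponential series of wave functions. For the three generators above the
series converges absolutely at every point, see `summable_expI_genA` and its companions below:
each of them conserves the total photon number and the photon times, and so acts on the values of
the wave functions at finitely many points at a time. -/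
def expI (G : TwoField → TwoField) (Ψ : TwoField) : TwoField := fun n m s u =>
  ∑' j : ℕ, Complex.I ^ j / (j.factorial : ℂ) * (G^[j] Ψ) n m s u

/-- `U_A = exp[i ∫ dt φ(t) a†(t) a(t)]`, the phase modulation. -/
def UA (φ : ℝ → ℝ) : TwoField → TwoField := expI (genA φ)

/-- `U_B = exp[i ∫ dt θ(t) b†(t) b(t)]`. -/
def UB (θ : ℝ → ℝ) : TwoField → TwoField := expI (genB θ)

/-- `U_AB = exp{iκ ∫ dt [a†(t) b(t) + a(t) b†(t)]}`, the loss. -/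
def UAB (κ : ℝ) : TwoField → TwoField := expI (genAB κ)

/-- The fidelity `F = |⟨Ψ| U_AB† U_B† U_A U_AB |Ψ⟩|²` with `|Ψ⟩ = |ψ⟩_A ⊗ |0⟩_B`. -/
def fidelity (t₀ t₁ κ : ℝ) (φ θ : ℝ → ℝ) (ψ : Field) : ℝ :=
  ‖braket t₀ t₁ (UB θ (UAB κ (tensorVacuum ψ))) (UA φ (UAB κ (tensorVacuum ψ)))‖ ^ 2

/-- The mean photon flux `⟨I(t)⟩ = ⟨ψ| a†(t) a(t) |ψ⟩ = ‖a(t) ψ‖²`. -/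
def meanFlux (t₀ t₁ : ℝ) (ψ : Field) (t : ℝ) : ℝ≥0∞ :=
  normSq t₀ t₁ (annA t (tensorVacuum ψ))

/-- Condition (I) or (II) on a phase `φ` at quantum efficiency `η`. -/
def PhaseCondition (η φ : ℝ) : Prop :=
  η < 1 / 2 ∨ (1 / 2 ≤ η ∧ |Real.sin φ| ≤ (1 - η) / η ∧ 0 < Real.cos φ)

/-- `z = η e^{iφ} + (1 - η) e^{-iθ}`. -/
def zFun (η φ θ : ℝ) : ℂ :=
  η * Complex.exp (Complex.I * φ) + (1 - η) * Complex.exp (-(Complex.I * θ))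

/-- `z` is real and positive at all times of `[t₀, t₁]`. -/
def ZPos (t₀ t₁ η : ℝ) (φ θ : ℝ → ℝ) : Prop :=
  ∀ t ∈ Set.Icc t₀ t₁, (zFun η (φ t) (θ t)).im = 0 ∧ 0 < (zFun η (φ t) (θ t)).re

/-- `∫ dt ⟨I(t)⟩ ln z²(t)` over `[t₀, t₁]`, for `z` real and positive. As `|z| ≤ 1`, the integrand
is nowhere positive, so the integral always exists in `[-∞, 0]`: it is minus the Lebesgue integral
of `⟨I(t)⟩ (-ln z²(t))`. -/
def fluxLogIntegral (t₀ t₁ η : ℝ) (φ θ : ℝ → ℝ) (ψ : Field) : EReal :=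
  -((∫⁻ t in Set.Icc t₀ t₁, meanFlux t₀ t₁ ψ t *
      ENNReal.ofReal (-Real.log ((zFun η (φ t) (θ t)).re ^ 2)) : ℝ≥0∞) : EReal)

/-! Absolute convergence of the exponential series. -/

/-- `Ψ` is bounded by `M` at all configurations of `N` photons with times in `T`. -/
def BddOn (T : Finset ℝ) (N : ℕ) (M : ℝ) (Ψ : TwoField) : Prop :=
  ∀ n m : ℕ, n + m = N → ∀ (s : Fin n → ℝ) (u : Fin m → ℝ),
    (∀ k, s k ∈ T) → (∀ k, u k ∈ T) → ‖Ψ n m s u‖ ≤ M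

theorem exists_bddOn (T : Finset ℝ) (N : ℕ) (Ψ : TwoField) : ∃ M, 0 ≤ M ∧ BddOn T N M Ψ := by
  classical
  let f : (Σ p : Fin (N + 1) × Fin (N + 1), (Fin p.1 → T) × (Fin p.2 → T)) → ℝ :=
    fun x => ‖Ψ x.1.1 x.1.2 (fun k => x.2.1 k) (fun k => x.2.2 k)‖
  refine ⟨∑ x, f x, Finset.sum_nonneg fun x _ => norm_nonneg _, ?_⟩
  intro n m h s u hs hu
  exact Finset.single_le_sum (f := f) (fun x _ => norm_nonneg _)
    (Finset.mem_univ ⟨(⟨n, by omega⟩, ⟨m, by omega⟩), (fun k => ⟨s k, hs k⟩, fun k => ⟨u k, hu k⟩)⟩)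

theorem summable_of_bddOn {G : TwoField → TwoField} {T : Finset ℝ} {N : ℕ} {C : ℝ}
    (hG : ∀ M Ψ, 0 ≤ M → BddOn T N M Ψ → BddOn T N (C * M) (G Ψ)) (hC : 0 ≤ C)
    (Ψ : TwoField) {n m : ℕ} (h : n + m = N) (s : Fin n → ℝ) (u : Fin m → ℝ)
    (hs : ∀ k, s k ∈ T) (hu : ∀ k, u k ∈ T) :
    Summable fun j : ℕ => Complex.I ^ j / (j.factorial : ℂ) * (G^[j] Ψ) n m s u := by
  obtain ⟨M, hM, hb⟩ := exists_bddOn T N Ψ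
  have key : ∀ j : ℕ, BddOn T N (C ^ j * M) (G^[j] Ψ) := by
    intro j
    induction j with
    | zero => simpa using hb
    | succ j ih =>
      rw [Function.iterate_succ_apply', pow_succ', mul_assoc]
      exact hG _ _ (by positivity) ih
  refine Summable.of_norm_bounded (g := fun j : ℕ => C ^ j / j.factorial * M)
    ((Real.summable_pow_div_factorial C).mul_right M) fun j => ?_
  have := key j n m h s u hs hu
  simp only [norm_mul, norm_div, norm_pow, Complex.norm_I, one_pow, Complex.norm_natCast]
  calc 1 / (j.factorial : ℝ) * ‖(G^[j] Ψ) n m s u‖ ≤ 1 / (j.factorial : ℝ) * (C ^ j * M) := by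
        gcongr
    _ = _ := by ring

theorem createA_bound {Φ : ℝ → TwoField} {T : Finset ℝ} {N : ℕ} {K : ℝ} (hK : 0 ≤ K)
    (hΦ : ∀ t ∈ T, ∀ n m : ℕ, n + 1 + m = N → ∀ (s : Fin n → ℝ) (u : Fin m → ℝ),
      (∀ k, s k ∈ T) → (∀ k, u k ∈ T) → ‖Φ t n m s u‖ ≤ K) :
    BddOn T N (N * K) (createA Φ) := by
  intro n m h s u hs hu
  match n, h, s, hs with
  | 0, h, s, hs => simpa [createA] using by positivity
  | n + 1, h, s, hs =>
    have h1 : (1 : ℝ) ≤ Real.sqrt (n + 1) := by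
      rw [Real.one_le_sqrt]; linarith [(Nat.cast_nonneg n : (0 : ℝ) ≤ n)]
    have h2 : ‖∑ k : Fin (n + 1), Φ (s k) n m (k.removeNth s) u‖ ≤ (N : ℝ) * K := by
      refine (norm_sum_le_of_le (f := fun k : Fin (n + 1) => Φ (s k) n m (k.removeNth s) u) _
        (fun k _ => hΦ (s k) (hs k) n m h _ u (fun j => hs _) hu)).trans ?_
      rw [Finset.sum_const, Finset.card_univ, Fintype.card_fin, nsmul_eq_mul]
      gcongr
      omega
    simp only [createA, norm_mul, norm_inv, Complex.norm_real, Real.norm_eq_abs,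
      abs_of_nonneg (Real.sqrt_nonneg _)]
    calc _ ≤ 1 * ‖∑ k : Fin (n + 1), Φ (s k) n m (k.removeNth s) u‖ := by
          gcongr; exact inv_le_one_of_one_le₀ h1
      _ ≤ _ := by simpa using h2

theorem createB_bound {Φ : ℝ → TwoField} {T : Finset ℝ} {N : ℕ} {K : ℝ} (hK : 0 ≤ K)
    (hΦ : ∀ t ∈ T, ∀ n m : ℕ, n + (m + 1) = N → ∀ (s : Fin n → ℝ) (u : Fin m → ℝ),
      (∀ k, s k ∈ T) → (∀ k, u k ∈ T) → ‖Φ t n m s u‖ ≤ K) :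
    BddOn T N (N * K) (createB Φ) := by
  intro n m h s u hs hu
  match m, h, u, hu with
  | 0, h, u, hu => simpa [createB] using by positivity
  | m + 1, h, u, hu =>
    have h1 : (1 : ℝ) ≤ Real.sqrt (m + 1) := by
      rw [Real.one_le_sqrt]; linarith [(Nat.cast_nonneg m : (0 : ℝ) ≤ m)]
    have h2 : ‖∑ k : Fin (m + 1), Φ (u k) n m s (k.removeNth u)‖ ≤ (N : ℝ) * K := by
      refine (norm_sum_le_of_le (f := fun k : Fin (m + 1) => Φ (u k) n m s (k.removeNth u)) _
        (fun k _ => hΦ (u k) (hu k) n m h s _ hs (fun j => hu _))).trans ?_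
      rw [Finset.sum_const, Finset.card_univ, Fintype.card_fin, nsmul_eq_mul]
      gcongr
      omega
    simp only [createB, norm_mul, norm_inv, Complex.norm_real, Real.norm_eq_abs,
      abs_of_nonneg (Real.sqrt_nonneg _)]
    calc _ ≤ 1 * ‖∑ k : Fin (m + 1), Φ (u k) n m s (k.removeNth u)‖ := by
          gcongr; exact inv_le_one_of_one_le₀ h1
      _ ≤ _ := by simpa using h2

theorem annA_bound {Ψ : TwoField} {T : Finset ℝ} {N : ℕ} {M : ℝ}
    (hb : BddOn T N M Ψ) {t : ℝ} (ht : t ∈ T) {n m : ℕ} (h : n + 1 + m = N)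
    (s : Fin n → ℝ) (u : Fin m → ℝ) (hs : ∀ k, s k ∈ T) (hu : ∀ k, u k ∈ T) :
    ‖annA t Ψ n m s u‖ ≤ N * M := by
  have h1 : Real.sqrt (n + 1) ≤ (N : ℝ) := by
    have h3 : (n : ℝ) + 1 ≤ N := by exact_mod_cast (by omega : n + 1 ≤ N)
    refine le_trans ?_ h3
    rw [Real.sqrt_le_left (by positivity)]
    nlinarith [(Nat.cast_nonneg n : (0 : ℝ) ≤ n)]
  have h2 := hb (n + 1) m h (Fin.cons t s) u (fun k => by
    refine Fin.cases ?_ (fun j => ?_) k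
    · simpa using ht
    · simpa using hs j) hu
  simp only [annA, norm_mul, Complex.norm_real, Real.norm_eq_abs,
    abs_of_nonneg (Real.sqrt_nonneg _)]
  gcongr

theorem annB_bound {Ψ : TwoField} {T : Finset ℝ} {N : ℕ} {M : ℝ}
    (hb : BddOn T N M Ψ) {t : ℝ} (ht : t ∈ T) {n m : ℕ} (h : n + (m + 1) = N)
    (s : Fin n → ℝ) (u : Fin m → ℝ) (hs : ∀ k, s k ∈ T) (hu : ∀ k, u k ∈ T) :
    ‖annB t Ψ n m s u‖ ≤ N * M := by
  have h1 : Real.sqrt (m + 1) ≤ (N : ℝ) := by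
    have h3 : (m : ℝ) + 1 ≤ N := by exact_mod_cast (by omega : m + 1 ≤ N)
    refine le_trans ?_ h3
    rw [Real.sqrt_le_left (by positivity)]
    nlinarith [(Nat.cast_nonneg m : (0 : ℝ) ≤ m)]
  have h2 := hb n (m + 1) h s (Fin.cons t u) hs (fun k => by
    refine Fin.cases ?_ (fun j => ?_) k
    · simpa using ht
    · simpa using hu j)
  simp only [annB, norm_mul, Complex.norm_real, Real.norm_eq_abs,
    abs_of_nonneg (Real.sqrt_nonneg _)]
  gcongr

theorem exists_time_finset {n m : ℕ} (s : Fin n → ℝ) (u : Fin m → ℝ) :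
    ∃ T : Finset ℝ, (∀ k, s k ∈ T) ∧ ∀ k, u k ∈ T := by
  classical
  exact ⟨Finset.univ.image s ∪ Finset.univ.image u, fun k => by simp, fun k => by simp⟩

theorem exists_abs_bound (T : Finset ℝ) (φ : ℝ → ℝ) :
    ∃ c, 0 ≤ c ∧ ∀ t ∈ T, |φ t| ≤ c :=
  ⟨∑ t ∈ T, |φ t|, Finset.sum_nonneg fun _ _ => abs_nonneg _, fun t ht =>
    Finset.single_le_sum (f := fun t => |φ t|) (fun _ _ => abs_nonneg _) ht⟩

theorem summable_expI_genA (φ : ℝ → ℝ) (Ψ : TwoField) (n m : ℕ) (s : Fin n → ℝ)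
    (u : Fin m → ℝ) : Summable fun j : ℕ =>
      Complex.I ^ j / (j.factorial : ℂ) * ((genA φ)^[j] Ψ) n m s u := by
  obtain ⟨T, hs, hu⟩ := exists_time_finset s u
  obtain ⟨c, hc, hφ⟩ := exists_abs_bound T φ
  let N : ℕ := n + m
  refine summable_of_bddOn (T := T) (N := N) (C := N * (c * N)) (fun M Ψ hM hb => ?_)
    (by positivity) Ψ rfl s u hs hu
  have := createA_bound (Φ := fun t => (φ t : ℂ) • annA t Ψ) (T := T) (N := N) (K := c * (N * M))
    (by positivity) fun t ht n m h s u hs hu => by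
      have h1 := annA_bound hb ht h s u hs hu
      simp only [Pi.smul_apply, norm_smul, Complex.norm_real, Real.norm_eq_abs]
      gcongr
      exact hφ t ht
  rwa [show (N : ℝ) * (c * N) * M = N * (c * (N * M)) by ring]

theorem summable_expI_genB (θ : ℝ → ℝ) (Ψ : TwoField) (n m : ℕ) (s : Fin n → ℝ)
    (u : Fin m → ℝ) : Summable fun j : ℕ =>
      Complex.I ^ j / (j.factorial : ℂ) * ((genB θ)^[j] Ψ) n m s u := by
  obtain ⟨T, hs, hu⟩ := exists_time_finset s u
  obtain ⟨c, hc, hθ⟩ := exists_abs_bound T θ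
  let N : ℕ := n + m
  refine summable_of_bddOn (T := T) (N := N) (C := N * (c * N)) (fun M Ψ hM hb => ?_)
    (by positivity) Ψ rfl s u hs hu
  have := createB_bound (Φ := fun t => (θ t : ℂ) • annB t Ψ) (T := T) (N := N) (K := c * (N * M))
    (by positivity) fun t ht n m h s u hs hu => by
      have h1 := annB_bound hb ht h s u hs hu
      simp only [Pi.smul_apply, norm_smul, Complex.norm_real, Real.norm_eq_abs]
      gcongr
      exact hθ t ht
  rwa [show (N : ℝ) * (c * N) * M = N * (c * (N * M)) by ring]

theorem summable_expI_genAB (κ : ℝ) (Ψ : TwoField) (n m : ℕ) (s : Fin n → ℝ)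
    (u : Fin m → ℝ) : Summable fun j : ℕ =>
      Complex.I ^ j / (j.factorial : ℂ) * ((genAB κ)^[j] Ψ) n m s u := by
  obtain ⟨T, hs, hu⟩ := exists_time_finset s u
  let N : ℕ := n + m
  refine summable_of_bddOn (T := T) (N := N) (C := |κ| * (N * N + N * N))
    (fun M Ψ hM hb => ?_) (by positivity) Ψ rfl s u hs hu
  have hA := createA_bound (Φ := fun t => annB t Ψ) (T := T) (N := N) (K := N * M)
    (by positivity) fun _ ht n m h s u hs hu => annB_bound hb ht (by omega) s u hs hu
  have hB := createB_bound (Φ := fun t => annA t Ψ) (T := T) (N := N) (K := N * M)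
    (by positivity) fun _ ht n m h s u hs hu => annA_bound hb ht (by omega) s u hs hu
  intro n m h s u hs hu
  have h1 := hA n m h s u hs hu
  have h2 := hB n m h s u hs hu
  simp only [genAB, Pi.smul_apply, Pi.add_apply, norm_smul, Complex.norm_real, Real.norm_eq_abs]
  rw [mul_assoc]
  gcongr
  refine (norm_add_le _ _).trans ?_
  linarith

end LossyPhase

end

/-! Symmetry makes each wave function of `ψ` a function `g` of the multiset of photon times. On such
functions the phase generators are multiplication by `∑ φ(sₖ)` and `∑ θ(uₖ)`, so `UA` and `UB`
multiply by phases. The loss sends each photon independently to `A` with amplitude `cos κ` or to `B`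
with amplitude `i sin κ`: `UAB_tensorVacuum` gives the wave function `√(n+m choose n) (cos κ)ⁿ (i
sin κ)ᵐ g`.

In the overlap, the terms with `n + m = N` then recombine by the binomial theorem, each photon
contributing `η e^{iφ} + (1 - η) e^{-iθ} = z`. Hence `braket_eq`: the overlap is `∑_N ∫ |ψ_N|² ∏
z(tᵢ)`, the mean of `∏ z(tᵢ)` over the photon statistics of `ψ`.

For `z > 0` this is the mean of `exp (∑ ln z(tᵢ))`. By Jensen's inequality it is at least the
exponential of the mean of `∑ ln z(tᵢ)`, which is `½ ∫ ⟨I⟩ ln z²` because the flux is the density of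
photon times (`lintegral_meanFlux_mul`). Squaring gives the bound (`fidelity_bound`). A suitable `θ`
solves `(1 - η) sin θ = η sin φ` with `cos θ ≥ 0` (`zFun_arcsin`). -/

noncomputable section

namespace LossyPhase

/-! ### Wave functions as functions of the multiset of photon times -/

/-- The photon times of a configuration, as a multiset. -/
def config {n : ℕ} (s : Fin n → ℝ) : Multiset ℝ := ∑ i, {s i}

theorem config_cons {n : ℕ} (t : ℝ) (s : Fin n → ℝ) :
    config (Fin.cons t s : Fin (n + 1) → ℝ) = {t} + config s := by
  simp [config, Fin.sum_univ_succ]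

theorem config_eq_add_removeNth {n : ℕ} (s : Fin (n + 1) → ℝ) (k : Fin (n + 1)) :
    config s = {s k} + config (k.removeNth s) := by
  simp [config, Fin.sum_univ_succAbove _ k, Fin.removeNth]

theorem config_cons_removeNth {n : ℕ} (s : Fin (n + 1) → ℝ) (k : Fin (n + 1)) :
    config (Fin.cons (s k) (k.removeNth s) : Fin (n + 1) → ℝ) = config s := by
  rw [config_cons, ← config_eq_add_removeNth]

theorem config_elim {n m N : ℕ} (e : Fin N ≃ Fin n ⊕ Fin m) (s : Fin n → ℝ) (u : Fin m → ℝ) :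
    config (fun i => Sum.elim s u (e i)) = config s + config u := by
  simp [config, e.sum_comp fun i => ({Sum.elim s u i} : Multiset ℝ), Fintype.sum_sum_type]

theorem config_eq_coe_ofFn {n : ℕ} (s : Fin n → ℝ) : config s = (List.ofFn s : Multiset ℝ) := by
  induction n with
  | zero => simp [config]
  | succ n ih =>
    have := ih (fun i => s i.succ)
    simp only [config] at this ⊢
    rw [Fin.sum_univ_succ, List.ofFn_succ, this]
    rfl

theorem eq_of_config_eq {n : ℕ} {f : (Fin n → ℝ) → ℂ}
    (hf : ∀ (σ : Equiv.Perm (Fin n)) t, f (t ∘ σ) = f t) {s t : Fin n → ℝ}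
    (h : config s = config t) : f s = f t := by
  -- Sorting both tuples brings equal multisets to the same tuple.
  rw [← hf (Tuple.sort s) s, ← hf (Tuple.sort t) t]
  congr 1
  refine List.ofFn_injective (List.Perm.eq_of_sortedLE
    (Tuple.monotone_sort s).sortedLE_ofFn (Tuple.monotone_sort t).sortedLE_ofFn ?_)
  refine (Equiv.Perm.ofFn_comp_perm _ s).trans (.trans ?_ (Equiv.Perm.ofFn_comp_perm _ t).symm)
  rw [config_eq_coe_ofFn, config_eq_coe_ofFn] at h
  exact Multiset.coe_eq_coe.1 h

theorem exists_eq_config {t₀ t₁ : ℝ} {ψ : Field} (hψ : IsState t₀ t₁ ψ) :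
    ∃ g : Multiset ℝ → ℂ, ∀ (n : ℕ) (s : Fin n → ℝ), ψ n s = g (config s) := by
  classical
  refine ⟨fun M => ψ (Multiset.card M) fun i => M.toList.get (i.cast (by simp)), ?_⟩
  intro n s
  -- A free `N` allows substitution: the cardinality of `config s` equals `n` only propositionally.
  have key : ∀ (N : ℕ) (hN : N = n) (x : Fin N → ℝ), config x = config s → ψ n s = ψ N x := by
    rintro N rfl x hx
    exact (eq_of_config_eq (hψ.symmetric N) hx).symm
  refine key _ (by simp [config]) _ ?_
  rw [config_eq_coe_ofFn]
  refine Eq.trans (congrArg _ ?_) (Multiset.coe_toList (config s))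
  refine List.ext_get (by simp) fun i h1 h2 => by simp

/-! ### Phase modulation as multiplication -/

/-- Removing the time `s k` and reinserting it in front preserves the multiset, so every term
contains the same value of `Ψ`; the two factors `√(n+1)` cancel. -/
theorem genA_eq (φ : ℝ → ℝ) {Ψ : TwoField} {G : ∀ n m : ℕ, Multiset ℝ → (Fin m → ℝ) → ℂ}
    (hΨ : ∀ n m s u, Ψ n m s u = G n m (config s) u) (n m : ℕ) (s : Fin n → ℝ)
    (u : Fin m → ℝ) : genA φ Ψ n m s u = (∑ k, (φ (s k) : ℂ)) * Ψ n m s u := by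
  cases n with
  | zero => simp [genA, createA]
  | succ n =>
    have h0 : (Real.sqrt (n + 1) : ℂ) ≠ 0 := by
      exact_mod_cast (Real.sqrt_pos.2 (by positivity)).ne'
    simp only [genA, createA, annA, Pi.smul_apply, smul_eq_mul, hΨ, config_cons_removeNth]
    rw [Finset.mul_sum, Finset.sum_mul]
    refine Finset.sum_congr rfl fun k _ => ?_
    field_simp

theorem genB_eq (θ : ℝ → ℝ) {Ψ : TwoField} {G : ∀ n m : ℕ, (Fin n → ℝ) → Multiset ℝ → ℂ}
    (hΨ : ∀ n m s u, Ψ n m s u = G n m s (config u)) (n m : ℕ) (s : Fin n → ℝ)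
    (u : Fin m → ℝ) : genB θ Ψ n m s u = (∑ k, (θ (u k) : ℂ)) * Ψ n m s u := by
  cases m with
  | zero => simp [genB, createB]
  | succ m =>
    have h0 : (Real.sqrt (m + 1) : ℂ) ≠ 0 := by
      exact_mod_cast (Real.sqrt_pos.2 (by positivity)).ne'
    simp only [genB, createB, annB, Pi.smul_apply, smul_eq_mul, hΨ, config_cons_removeNth]
    rw [Finset.mul_sum, Finset.sum_mul]
    refine Finset.sum_congr rfl fun k _ => ?_
    field_simp

theorem sum_eq_sum_map_config {n : ℕ} (f : ℝ → ℂ) (s : Fin n → ℝ) :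
    ∑ k, f (s k) = ((config s).map f).sum := by
  rw [config_eq_coe_ofFn, Multiset.map_coe, Multiset.sum_coe, List.map_ofFn, List.sum_ofFn]
  rfl

theorem tsum_I_pow_mul (x y : ℂ) :
    ∑' j : ℕ, Complex.I ^ j / (j.factorial : ℂ) * (x ^ j * y) = Complex.exp (Complex.I * x) * y := by
  rw [Complex.exp_eq_exp_ℂ, NormedSpace.exp_eq_tsum_div, ← tsum_mul_right]
  refine tsum_congr fun j => ?_
  rw [mul_pow]
  ring

theorem UA_eq (φ : ℝ → ℝ) {Ψ : TwoField} {G : ∀ n m : ℕ, Multiset ℝ → (Fin m → ℝ) → ℂ}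
    (hΨ : ∀ n m s u, Ψ n m s u = G n m (config s) u) (n m : ℕ) (s : Fin n → ℝ)
    (u : Fin m → ℝ) :
    UA φ Ψ n m s u = Complex.exp (Complex.I * ∑ k, (φ (s k) : ℂ)) * Ψ n m s u := by
  have key : ∀ (j n m : ℕ) (s : Fin n → ℝ) (u : Fin m → ℝ),
      ((genA φ)^[j] Ψ) n m s u = (∑ k, (φ (s k) : ℂ)) ^ j * Ψ n m s u := by
    intro j
    induction j with
    | zero => simp
    | succ j ih =>
      intro n m s u
      -- The iterate stays symmetric in `s`, since its factor is a sum over the multiset of times.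
      rw [Function.iterate_succ_apply', genA_eq φ
        (G := fun n m M u => ((M.map fun t => (φ t : ℂ)).sum) ^ j * G n m M u), ih]
      · ring
      · intro n m s u
        rw [ih, hΨ, sum_eq_sum_map_config fun t => (φ t : ℂ)]
  simp only [UA, expI, key, tsum_I_pow_mul]

theorem UB_eq (θ : ℝ → ℝ) {Ψ : TwoField} {G : ∀ n m : ℕ, (Fin n → ℝ) → Multiset ℝ → ℂ}
    (hΨ : ∀ n m s u, Ψ n m s u = G n m s (config u)) (n m : ℕ) (s : Fin n → ℝ)
    (u : Fin m → ℝ) :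
    UB θ Ψ n m s u = Complex.exp (Complex.I * ∑ k, (θ (u k) : ℂ)) * Ψ n m s u := by
  have key : ∀ (j n m : ℕ) (s : Fin n → ℝ) (u : Fin m → ℝ),
      ((genB θ)^[j] Ψ) n m s u = (∑ k, (θ (u k) : ℂ)) ^ j * Ψ n m s u := by
    intro j
    induction j with
    | zero => simp
    | succ j ih =>
      intro n m s u
      rw [Function.iterate_succ_apply', genB_eq θ
        (G := fun n m s M => ((M.map fun t => (θ t : ℂ)).sum) ^ j * G n m s M), ih]
      · ring
      · intro n m s u
        rw [ih, hΨ, sum_eq_sum_map_config fun t => (θ t : ℂ)]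
  simp only [UB, expI, key, tsum_I_pow_mul]

/-! ### The beam splitter with vacuum in `B` -/

/-- The beam splitter generator on the coefficients `d n m` of `√(n+m choose n) d n m g`. -/
def hop (d : ℕ → ℕ → ℂ) : ℕ → ℕ → ℂ := fun n m => n * d (n - 1) (m + 1) + m * d (n + 1) (m - 1)

/-- The two-field vector with wave functions `√(n+m choose n) d n m g`. -/
def split (g : Multiset ℝ → ℂ) (d : ℕ → ℕ → ℂ) : TwoField := fun n m s u =>
  (Real.sqrt ((n + m).choose n) : ℂ) * (d n m * g (config s + config u))

theorem sqrt_choose_succ (n m : ℕ) :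
    Real.sqrt (m + 1) * Real.sqrt ((n + (m + 1)).choose n) =
      Real.sqrt (n + 1) * Real.sqrt ((n + 1 + m).choose (n + 1)) := by
  rw [← Real.sqrt_mul (by positivity), ← Real.sqrt_mul (by positivity)]
  congr 1
  have h := Nat.choose_succ_right_eq (n + m + 1) n
  rw [show n + m + 1 - n = m + 1 by omega] at h
  rw [show n + (m + 1) = n + m + 1 by omega, show n + 1 + m = n + m + 1 by omega]
  have h' : ((n + m + 1).choose (n + 1) : ℝ) * (n + 1) = (n + m + 1).choose n * (m + 1) := by
    exact_mod_cast h
  linarith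

/-- Moving a photon between the fields leaves `config s + config u` unchanged, so all terms of each
creation sum agree, and `sqrt_choose_succ` absorbs the square roots. The truncated `n - 1` and `m -
1` in `hop` are harmless: their coefficients vanish at `0`. -/
theorem genAB_split (κ : ℝ) (g : Multiset ℝ → ℂ) (d : ℕ → ℕ → ℂ) :
    genAB κ (split g d) = split g (fun n m => κ * hop d n m) := by
  have hA : ∀ (n m : ℕ) (s : Fin n → ℝ) (u : Fin m → ℝ),
      createA (fun t => annB t (split g d)) n m s u = (Real.sqrt ((n + m).choose n) : ℂ) *
        (n * d (n - 1) (m + 1) * g (config s + config u)) := by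
    intro n m s u
    cases n with
    | zero => simp [createA]
    | succ n =>
      have h0 : (Real.sqrt (n + 1) : ℂ) ≠ 0 := by
        exact_mod_cast (Real.sqrt_pos.2 (by positivity)).ne'
      have h1 : (Real.sqrt (m + 1) : ℂ) * Real.sqrt ((n + (m + 1)).choose n) =
          Real.sqrt (n + 1) * Real.sqrt ((n + 1 + m).choose (n + 1)) := by
        exact_mod_cast sqrt_choose_succ n m
      have h2 : ∀ k : Fin (n + 1), config (k.removeNth s) +
          config (Fin.cons (s k) u : Fin (m + 1) → ℝ) = config s + config u := by
        intro k
        rw [config_cons, config_eq_add_removeNth s k]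
        abel
      simp only [createA, annB, split, h2, ← mul_assoc, h1]
      simp only [Finset.sum_const, Finset.card_univ, Fintype.card_fin, nsmul_eq_mul,
        Nat.add_sub_cancel]
      field_simp
  have hB : ∀ (n m : ℕ) (s : Fin n → ℝ) (u : Fin m → ℝ),
      createB (fun t => annA t (split g d)) n m s u = (Real.sqrt ((n + m).choose n) : ℂ) *
        (m * d (n + 1) (m - 1) * g (config s + config u)) := by
    intro n m s u
    cases m with
    | zero => simp [createB]
    | succ m =>
      have h0 : (Real.sqrt (m + 1) : ℂ) ≠ 0 := by
        exact_mod_cast (Real.sqrt_pos.2 (by positivity)).ne'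
      have h1 : (Real.sqrt (n + 1) : ℂ) * Real.sqrt ((n + 1 + m).choose (n + 1)) =
          Real.sqrt (m + 1) * Real.sqrt ((n + (m + 1)).choose n) := by
        exact_mod_cast (sqrt_choose_succ n m).symm
      have h2 : ∀ k : Fin (m + 1), config (Fin.cons (u k) s : Fin (n + 1) → ℝ) +
          config (k.removeNth u) = config s + config u := by
        intro k
        rw [config_cons, config_eq_add_removeNth u k]
        abel
      simp only [createB, annA, split, h2, ← mul_assoc, h1]
      simp only [Finset.sum_const, Finset.card_univ, Fintype.card_fin, nsmul_eq_mul,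
        Nat.add_sub_cancel]
      field_simp
  funext n m s u
  simp only [genAB, Pi.smul_apply, Pi.add_apply, hA, hB, smul_eq_mul, split, hop]
  ring

/-- The amplitudes of the beam splitter output for a vacuum input `B`. -/
def amp (z : ℂ) : ℕ → ℕ → ℂ := fun n m => Complex.cos z ^ n * (Complex.I * Complex.sin z) ^ m

/-- `amp` is the flow generated by `i · hop`: a rotation of the single-photon amplitudes `(cos z, i
sin z)`. -/
theorem hasDerivAt_amp (n m : ℕ) (z : ℂ) :
    HasDerivAt (fun z => amp z n m) (Complex.I * hop (amp z) n m) z := by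
  have h := ((Complex.hasDerivAt_cos z).pow n).mul
    (((Complex.hasDerivAt_sin z).const_mul Complex.I).pow m)
  refine HasDerivAt.congr_deriv h ?_
  simp only [hop, amp, pow_succ, Pi.pow_apply]
  -- `i² = -1` rewrites the derivative `-sin z` of `cos z` as `i · (i sin z)`.
  linear_combination (-n * Complex.cos z ^ (n - 1) * Complex.sin z *
    (Complex.I * Complex.sin z) ^ m) * Complex.I_sq

theorem hasDerivAt_iterate_hop_amp (j n m : ℕ) (z : ℂ) :
    HasDerivAt (fun z => (hop^[j] (amp z)) n m) (Complex.I * (hop^[j + 1] (amp z)) n m) z := by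
  induction j generalizing n m with
  | zero => exact hasDerivAt_amp n m z
  | succ j ih =>
    simp only [Function.iterate_succ_apply'] at ih ⊢
    have h := ((ih (n - 1) (m + 1)).const_mul (n : ℂ)).add
      ((ih (n + 1) (m - 1)).const_mul (m : ℂ))
    refine HasDerivAt.congr_deriv h ?_
    conv_rhs => rw [hop]
    ring

theorem iteratedDeriv_amp (j n m : ℕ) :
    iteratedDeriv j (fun z => amp z n m) = fun z => Complex.I ^ j * (hop^[j] (amp z)) n m := by
  induction j with
  | zero => simp
  | succ j ih =>
    rw [iteratedDeriv_succ, ih]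
    funext z
    rw [((hasDerivAt_iterate_hop_amp j n m z).const_mul (Complex.I ^ j)).deriv]
    ring

/-- Each derivative in `z` applies `i · hop`, so the exponential series started at `amp 0` is the
Taylor series at `0` of an entire function. -/
theorem tsum_hop_amp_zero (n m : ℕ) (z : ℂ) :
    ∑' j : ℕ, Complex.I ^ j / (j.factorial : ℂ) * (z ^ j * (hop^[j] (amp 0)) n m) =
      amp z n m := by
  have h := Complex.taylorSeries_eq_of_entire' 0 z (f := fun z => amp z n m)
    fun z => (hasDerivAt_amp n m z).differentiableAt
  rw [← h]
  refine tsum_congr fun j => ?_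
  rw [iteratedDeriv_amp, sub_zero]
  ring

theorem genAB_iterate_split (κ : ℝ) (g : Multiset ℝ → ℂ) (d : ℕ → ℕ → ℂ) (j : ℕ) :
    (genAB κ)^[j] (split g d) = split g (fun n m => κ ^ j * (hop^[j] d) n m) := by
  induction j with
  | zero => simp
  | succ j ih =>
    rw [Function.iterate_succ_apply', ih, genAB_split]
    congr 1
    funext n m
    rw [Function.iterate_succ_apply']
    simp only [hop]
    ring

/-- At angle `0` the factor `(i sin 0)ᵐ` vanishes unless `m = 0`. -/
theorem tensorVacuum_eq_split {ψ : Field} {g : Multiset ℝ → ℂ}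
    (hg : ∀ (n : ℕ) (s : Fin n → ℝ), ψ n s = g (config s)) :
    tensorVacuum ψ = split g (amp 0) := by
  funext n m s u
  cases m with
  | zero => simp [tensorVacuum, split, amp, hg, config]
  | succ m => simp [tensorVacuum, split, amp]

/-- The loss turns `|ψ⟩ ⊗ |0⟩` into a binomial superposition. -/
theorem UAB_tensorVacuum (κ : ℝ) {ψ : Field} {g : Multiset ℝ → ℂ}
    (hg : ∀ (n : ℕ) (s : Fin n → ℝ), ψ n s = g (config s)) :
    UAB κ (tensorVacuum ψ) = split g (amp κ) := by
  rw [tensorVacuum_eq_split hg]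
  funext n m s u
  simp only [UAB, expI, genAB_iterate_split, split]
  rw [← tsum_hop_amp_zero, ← tsum_mul_right, ← tsum_mul_left]
  refine tsum_congr fun j => ?_
  ring

theorem conj_amp_mul_amp (κ : ℝ) (n m : ℕ) :
    (starRingEnd ℂ) (amp κ n m) * amp κ n m =
      ((Real.cos κ ^ 2) ^ n * (1 - Real.cos κ ^ 2) ^ m : ℝ) := by
  rw [← Real.sin_sq, ← Complex.normSq_eq_conj_mul_self]
  congr 1
  simp only [amp, map_mul, map_pow, Complex.normSq_I, one_mul, ← Complex.ofReal_cos,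
    ← Complex.ofReal_sin, Complex.normSq_ofReal, ← sq]

/-! ### The overlap as a mean of `∏ z` -/

/-- The integrand of the overlap. -/
theorem conj_UB_mul_UA (κ : ℝ) (φ θ : ℝ → ℝ) {ψ : Field} {g : Multiset ℝ → ℂ}
    (hg : ∀ (n : ℕ) (s : Fin n → ℝ), ψ n s = g (config s)) (n m : ℕ) (s : Fin n → ℝ)
    (u : Fin m → ℝ) :
    (starRingEnd ℂ) (UB θ (UAB κ (tensorVacuum ψ)) n m s u) *
        UA φ (UAB κ (tensorVacuum ψ)) n m s u =
      ((n + m).choose n * ((Real.cos κ ^ 2) ^ n * (1 - Real.cos κ ^ 2) ^ m) : ℝ) *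
        ((‖g (config s + config u)‖ ^ 2 : ℝ) * ((∏ k, Complex.exp (Complex.I * φ (s k))) *
          ∏ k, Complex.exp (-(Complex.I * θ (u k))))) := by
  rw [UAB_tensorVacuum κ hg, UA_eq φ (Ψ := split g (amp κ))
      (G := fun n m M u => (Real.sqrt ((n + m).choose n) : ℂ) *
      (amp κ n m * g (M + config u))) (fun _ _ _ _ => rfl),
    UB_eq θ (Ψ := split g (amp κ)) (G := fun n m s M => (Real.sqrt ((n + m).choose n) : ℂ) *
      (amp κ n m * g (config s + M))) (fun _ _ _ _ => rfl)]
  have h1 : ((Real.sqrt ((n + m).choose n) : ℝ) : ℂ) * Real.sqrt ((n + m).choose n) =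
      ((n + m).choose n : ℝ) := by
    rw [← Complex.ofReal_mul, Real.mul_self_sqrt (by positivity)]
  have h2 : (starRingEnd ℂ) (g (config s + config u)) * g (config s + config u) =
      (‖g (config s + config u)‖ ^ 2 : ℝ) := by
    rw [← Complex.normSq_eq_conj_mul_self, Complex.normSq_eq_norm_sq]
  have h3 := conj_amp_mul_amp κ n m
  rw [← Complex.exp_sum, ← Complex.exp_sum, Complex.ofReal_mul, ← h1, ← h2, ← h3]
  simp only [split, map_mul, ← Complex.exp_conj, Complex.conj_ofReal, Complex.conj_I, map_sum,
    Finset.mul_sum, neg_mul, Finset.sum_neg_distrib]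
  ring

instance (t₀ t₁ : ℝ) (n : ℕ) : IsFiniteMeasure (timeMeasure t₀ t₁ n) := by
  unfold timeMeasure; infer_instance

theorem ae_timeMeasure_mem (t₀ t₁ : ℝ) (n : ℕ) :
    ∀ᵐ x ∂timeMeasure t₀ t₁ n, ∀ i, x i ∈ Set.Icc t₀ t₁ := by
  rw [timeMeasure, ← Measure.restrict_pi_pi]
  refine (ae_restrict_mem (MeasurableSet.univ_pi fun _ => measurableSet_Icc)).mono fun x hx i => ?_
  exact hx i (Set.mem_univ i)

/-- Times distributed over two fields, as times of a single field. -/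
def mergeEquiv {n m N : ℕ} (e : Fin N ≃ Fin n ⊕ Fin m) :
    (Fin n → ℝ) × (Fin m → ℝ) ≃ᵐ (Fin N → ℝ) :=
  (MeasurableEquiv.sumPiEquivProdPi fun _ : Fin n ⊕ Fin m => ℝ).symm.trans
    (MeasurableEquiv.piCongrLeft (fun _ => ℝ) e.symm)

theorem mergeEquiv_apply {n m N : ℕ} (e : Fin N ≃ Fin n ⊕ Fin m)
    (p : (Fin n → ℝ) × (Fin m → ℝ)) :
    mergeEquiv e p = fun i => Sum.elim p.1 p.2 (e i) := by
  funext i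
  obtain ⟨j, rfl⟩ := e.symm.surjective i
  simp only [mergeEquiv, MeasurableEquiv.trans_apply, MeasurableEquiv.coe_piCongrLeft,
    Equiv.piCongrLeft_apply_apply, Equiv.apply_symm_apply]
  cases j <;> rfl

theorem measurePreserving_mergeEquiv (t₀ t₁ : ℝ) {n m N : ℕ} (e : Fin N ≃ Fin n ⊕ Fin m) :
    MeasurePreserving (mergeEquiv e) ((timeMeasure t₀ t₁ n).prod (timeMeasure t₀ t₁ m))
      (timeMeasure t₀ t₁ N) :=
  (measurePreserving_piCongrLeft (fun _ => volume.restrict (Set.Icc t₀ t₁)) e.symm).comp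
    (measurePreserving_sumPiEquivProdPi_symm fun _ => volume.restrict (Set.Icc t₀ t₁))

/-- The contribution to the overlap of `n` photons in `A` and `m` photons in `B`. -/
def overlap (t₀ t₁ : ℝ) (g : Multiset ℝ → ℂ) (α β : ℝ → ℂ) (n m : ℕ) : ℂ :=
  ∫ x : (Fin n → ℝ) × (Fin m → ℝ),
    (‖g (config x.1 + config x.2)‖ ^ 2 : ℝ) * ((∏ k, α (x.1 k)) * ∏ k, β (x.2 k))
      ∂((timeMeasure t₀ t₁ n).prod (timeMeasure t₀ t₁ m))

/-- Relabelling the photons so that those of `S` form field `A` preserves the measure and the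
multiset of times, so only the size of `S` matters. -/
theorem integral_subset_eq_overlap (t₀ t₁ : ℝ) {ψ : Field} {g : Multiset ℝ → ℂ}
    (hg : ∀ (n : ℕ) (s : Fin n → ℝ), ψ n s = g (config s)) (α β : ℝ → ℂ) {N : ℕ}
    (S : Finset (Fin N)) :
    ∫ x, (‖ψ N x‖ ^ 2 : ℝ) * ((∏ i ∈ S, α (x i)) * ∏ i ∈ Finset.univ \ S, β (x i))
      ∂timeMeasure t₀ t₁ N = overlap t₀ t₁ g α β S.card (N - S.card) := by
  have hc : Sᶜ.card = N - S.card := by rw [Finset.card_compl, Fintype.card_fin]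
  let e : Fin N ≃ Fin S.card ⊕ Fin (N - S.card) := (finSumEquivOfFinset rfl hc).symm
  have hl : ∀ k, e.symm (Sum.inl k) ∈ S := fun k => by
    simp [e]
  have hr : ∀ k, e.symm (Sum.inr k) ∉ S := fun k => by
    have : (Sᶜ.orderEmbOfFin hc) k ∈ Sᶜ := Finset.orderEmbOfFin_mem _ _ _
    simpa only [e, Equiv.symm_symm, finSumEquivOfFinset_inr, Finset.mem_compl] using this
  rw [← (measurePreserving_mergeEquiv t₀ t₁ e).integral_comp', overlap]
  congr 1
  funext p
  have hprod : ∀ x : Fin N → ℝ, (∏ i ∈ S, α (x i)) * ∏ i ∈ Finset.univ \ S, β (x i) =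
      ∏ i, if i ∈ S then α (x i) else β (x i) := by
    intro x
    rw [Finset.prod_ite]
    congr 2 <;> ext i <;> simp
  rw [mergeEquiv_apply, hg, config_elim, hprod, ← e.symm.prod_comp, Fintype.prod_sum_type]
  simp [hl, hr]

/-- The probability density of `N` photons is integrable. -/
theorem integrable_norm_sq {t₀ t₁ : ℝ} {ψ : Field} (hψ : IsState t₀ t₁ ψ) (N : ℕ) :
    Integrable (fun x => ‖ψ N x‖ ^ 2) (timeMeasure t₀ t₁ N) := by
  refine ⟨((hψ.measurable N).norm.pow_const 2).aestronglyMeasurable, ?_⟩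
  have h := ENNReal.le_tsum (f := fun n => ∫⁻ t, ‖ψ n t‖ₑ ^ 2 ∂(timeMeasure t₀ t₁ n)) N
  rw [hψ.norm_eq_one] at h
  refine lt_of_le_of_lt ?_ (h.trans_lt ENNReal.one_lt_top)
  simp

theorem lintegral_norm_sq_mul {t₀ t₁ : ℝ} {ψ : Field} (hψ : IsState t₀ t₁ ψ) (N : ℕ)
    {f : (Fin N → ℝ) → ℝ} (hf : Measurable f) (h0 : ∀ᵐ x ∂timeMeasure t₀ t₁ N, 0 ≤ f x)
    (h1 : ∀ᵐ x ∂timeMeasure t₀ t₁ N, f x ≤ 1) :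
    ENNReal.ofReal (∫ x, ‖ψ N x‖ ^ 2 * f x ∂timeMeasure t₀ t₁ N) =
      ∫⁻ x, ‖ψ N x‖ₑ ^ 2 * ENNReal.ofReal (f x) ∂timeMeasure t₀ t₁ N := by
  rw [ofReal_integral_eq_lintegral_ofReal]
  · refine lintegral_congr fun x => ?_
    rw [ENNReal.ofReal_mul (by positivity), ENNReal.ofReal_pow (norm_nonneg _), ofReal_norm]
  · refine (integrable_norm_sq hψ N).mul_bdd (c := 1) hf.aestronglyMeasurable ?_
    filter_upwards [h0, h1] with x hx0 hx1
    rwa [Real.norm_of_nonneg hx0]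
  · filter_upwards [h0] with x hx0
    simp only [Pi.zero_apply]
    positivity

theorem summable_integral_norm_sq {t₀ t₁ : ℝ} {ψ : Field} (hψ : IsState t₀ t₁ ψ) :
    Summable fun N => ∫ x, ‖ψ N x‖ ^ 2 ∂timeMeasure t₀ t₁ N := by
  have h := hψ.norm_eq_one
  have h1 : ∀ N, ∫⁻ t, ‖ψ N t‖ₑ ^ 2 ∂(timeMeasure t₀ t₁ N) =
      ENNReal.ofReal (∫ x, ‖ψ N x‖ ^ 2 ∂timeMeasure t₀ t₁ N) := fun N => by
    have := lintegral_norm_sq_mul hψ N (f := fun _ => 1) measurable_const (by simp) (by simp)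
    simpa using this.symm
  simp only [h1] at h
  have h2 := ENNReal.summable_toReal (by rw [h]; exact ENNReal.one_ne_top)
  refine h2.congr fun N => ?_
  rw [ENNReal.toReal_ofReal (integral_nonneg fun x => by positivity)]

/-- The phases have modulus one, which leaves the `n + m` photon probability; it supplies the
majorant for the double series. -/
theorem norm_overlap_le (t₀ t₁ : ℝ) {ψ : Field} {g : Multiset ℝ → ℂ}
    (hg : ∀ (n : ℕ) (s : Fin n → ℝ), ψ n s = g (config s)) {α β : ℝ → ℂ}
    (hα : ∀ t, ‖α t‖ = 1) (hβ : ∀ t, ‖β t‖ = 1) (n m : ℕ) :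
    ‖overlap t₀ t₁ g α β n m‖ ≤ ∫ x, ‖ψ (n + m) x‖ ^ 2 ∂timeMeasure t₀ t₁ (n + m) := by
  rw [← (measurePreserving_mergeEquiv t₀ t₁ finSumFinEquiv.symm).integral_comp']
  refine (norm_integral_le_integral_norm _).trans (le_of_eq ?_)
  congr 1
  funext p
  rw [mergeEquiv_apply, hg, config_elim]
  simp [norm_prod, hα, hβ]

/-- The binomial sum over the photon numbers in the two fields. -/
theorem integral_prod_eq_sum_overlap {t₀ t₁ : ℝ} {ψ : Field} (hψ : IsState t₀ t₁ ψ)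
    {g : Multiset ℝ → ℂ} (hg : ∀ (n : ℕ) (s : Fin n → ℝ), ψ n s = g (config s)) {α β : ℝ → ℂ}
    (hαm : Measurable α) (hβm : Measurable β)
    (hα : ∀ t, ‖α t‖ = 1) (hβ : ∀ t, ‖β t‖ = 1) (a b : ℂ) (N : ℕ) :
    ∫ x, (‖ψ N x‖ ^ 2 : ℝ) * ∏ i, (a * α (x i) + b * β (x i)) ∂timeMeasure t₀ t₁ N =
      ∑ p ∈ Finset.HasAntidiagonal.antidiagonal N, ((p.1 + p.2).choose p.1 : ℂ) * (a ^ p.1 * b ^ p.2) *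
        overlap t₀ t₁ g α β p.1 p.2 := by
  have hexp : ∀ x : Fin N → ℝ, (‖ψ N x‖ ^ 2 : ℝ) * ∏ i, (a * α (x i) + b * β (x i)) =
      ∑ S ∈ (Finset.univ : Finset (Fin N)).powerset, a ^ S.card * b ^ (N - S.card) *
        ((‖ψ N x‖ ^ 2 : ℝ) * ((∏ i ∈ S, α (x i)) * ∏ i ∈ Finset.univ \ S, β (x i))) := by
    intro x
    rw [Finset.prod_add, Finset.mul_sum]
    refine Finset.sum_congr rfl fun S _ => ?_
    rw [Finset.prod_mul_distrib, Finset.prod_mul_distrib, Finset.prod_const, Finset.prod_const,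
      Finset.card_univ_sdiff, Fintype.card_fin]
    ring
  simp only [hexp]
  rw [integral_finsetSum]
  · simp only [integral_const_mul, integral_subset_eq_overlap t₀ t₁ hg]
    rw [Finset.sum_powerset_apply_card (fun k => a ^ k * b ^ (N - k) *
      overlap t₀ t₁ g α β k (N - k)), Finset.Nat.sum_antidiagonal_eq_sum_range_succ (fun n m =>
      ((n + m).choose n : ℂ) * (a ^ n * b ^ m) * overlap t₀ t₁ g α β n m)]
    rw [Finset.card_univ, Fintype.card_fin]
    refine Finset.sum_congr rfl fun k hk => ?_
    rw [Finset.mem_range] at hk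
    rw [Nat.add_sub_cancel' (by omega), nsmul_eq_mul]
    ring
  · intro S _
    refine Integrable.const_mul ?_ _
    refine (integrable_norm_sq hψ N).ofReal.mul_bdd (c := 1) ?_ (.of_forall fun x => ?_)
    · refine Measurable.aestronglyMeasurable ?_
      fun_prop
    · simp [norm_prod, hα, hβ]

/-- The overlap as an average of `∏ z`. -/
theorem tsum_overlap {t₀ t₁ : ℝ} {ψ : Field} (hψ : IsState t₀ t₁ ψ)
    {g : Multiset ℝ → ℂ} (hg : ∀ (n : ℕ) (s : Fin n → ℝ), ψ n s = g (config s)) {α β : ℝ → ℂ}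
    (hαm : Measurable α) (hβm : Measurable β)
    (hα : ∀ t, ‖α t‖ = 1) (hβ : ∀ t, ‖β t‖ = 1) {η : ℝ} (h0 : 0 ≤ η) (h1 : η ≤ 1) :
    ∑' p : ℕ × ℕ, ((p.1 + p.2).choose p.1 : ℂ) * ((η : ℂ) ^ p.1 * (1 - η : ℂ) ^ p.2) *
        overlap t₀ t₁ g α β p.1 p.2 =
      ∑' N, ∫ x, (‖ψ N x‖ ^ 2 : ℝ) * ∏ i, (η * α (x i) + (1 - η) * β (x i))
        ∂timeMeasure t₀ t₁ N := by
  have h1' : 0 ≤ 1 - η := by linarith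
  set P : ℕ → ℝ := fun N => ∫ x, ‖ψ N x‖ ^ 2 ∂timeMeasure t₀ t₁ N
  have hP0 : ∀ N, 0 ≤ P N := fun N => integral_nonneg fun x => by positivity
  -- The majorant: at fixed `N` its binomial weights sum to `(η + (1 - η))^N = 1`, leaving the
  -- summable `P N`. This justifies regrouping by total photon number.
  let B : ℕ × ℕ → ℝ := fun p => ((p.1 + p.2).choose p.1 : ℝ) * (η ^ p.1 * (1 - η) ^ p.2) *
    P (p.1 + p.2)
  have hB0 : ∀ p, 0 ≤ B p := fun p => by
    have := hP0 (p.1 + p.2)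
    positivity
  have hBsum : ∀ N, ∑ p ∈ Finset.HasAntidiagonal.antidiagonal N, B p = P N := by
    intro N
    have h2 := (Commute.all η (1 - η)).add_pow' N
    rw [add_sub_cancel, one_pow] at h2
    rw [← one_mul (P N), h2, Finset.sum_mul]
    refine Finset.sum_congr rfl fun p hp => ?_
    rw [Finset.HasAntidiagonal.mem_antidiagonal] at hp
    simp only [B, hp, nsmul_eq_mul]
  have hBs : Summable B := by
    rw [← (Finset.HasAntidiagonal.sigmaAntidiagonalEquivProd (A := ℕ)).summable_iff]
    refine (summable_sigma_of_nonneg fun _ => hB0 _).2 ?_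
    refine ⟨fun N => Summable.of_finite, (summable_integral_norm_sq hψ).congr fun N => ?_⟩
    rw [tsum_fintype]
    exact (hBsum N).symm.trans (Finset.sum_coe_sort _ B).symm
  have hs : Summable fun p : ℕ × ℕ => ((p.1 + p.2).choose p.1 : ℂ) *
      ((η : ℂ) ^ p.1 * (1 - η : ℂ) ^ p.2) * overlap t₀ t₁ g α β p.1 p.2 := by
    refine Summable.of_norm_bounded hBs fun p => ?_
    have h2 : ‖(1 - η : ℂ)‖ = 1 - η := by
      rw [← Complex.ofReal_one, ← Complex.ofReal_sub, Complex.norm_real, Real.norm_of_nonneg h1']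
    simp only [norm_mul, norm_pow, h2, Complex.norm_real, Real.norm_of_nonneg h0,
      Complex.norm_natCast, B]
    exact mul_le_mul_of_nonneg_left (norm_overlap_le t₀ t₁ hg hα hβ _ _) (by positivity)
  rw [← (Finset.HasAntidiagonal.sigmaAntidiagonalEquivProd (A := ℕ)).tsum_eq]
  refine (Summable.tsum_sigma' (fun N => Summable.of_finite)
    ((Finset.HasAntidiagonal.sigmaAntidiagonalEquivProd (A := ℕ)).summable_iff.2 hs)).trans ?_
  refine tsum_congr fun N => ?_
  rw [integral_prod_eq_sum_overlap hψ hg hαm hβm hα hβ, tsum_fintype]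
  exact Finset.sum_coe_sort (Finset.HasAntidiagonal.antidiagonal N) fun p : ℕ × ℕ =>
    ((p.1 + p.2).choose p.1 : ℂ) * ((η : ℂ) ^ p.1 * (1 - η : ℂ) ^ p.2) *
      overlap t₀ t₁ g α β p.1 p.2

theorem measurable_zFun {φ θ : ℝ → ℝ} (hφ : Measurable φ) (hθ : Measurable θ) (η : ℝ) :
    Measurable fun t => zFun η (φ t) (θ t) := by
  unfold zFun
  fun_prop

theorem norm_zFun_le_one {η : ℝ} (h0 : 0 ≤ η) (h1 : η ≤ 1) (φ θ : ℝ) : ‖zFun η φ θ‖ ≤ 1 := by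
  have h2 : ‖(1 - η : ℂ)‖ = 1 - η := by
    rw [← Complex.ofReal_one, ← Complex.ofReal_sub, Complex.norm_real,
      Real.norm_of_nonneg (by linarith)]
  refine (norm_add_le _ _).trans (le_of_eq ?_)
  rw [norm_mul, norm_mul, h2, Complex.norm_real, Real.norm_of_nonneg h0, Complex.norm_exp,
    Complex.norm_exp]
  simp

/-- The overlap of the two output states, for any phases. -/
theorem braket_eq {t₀ t₁ κ : ℝ} {φ θ : ℝ → ℝ} (hφ : Measurable φ) (hθ : Measurable θ)
    {ψ : Field} (hψ : IsState t₀ t₁ ψ) :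
    braket t₀ t₁ (UB θ (UAB κ (tensorVacuum ψ))) (UA φ (UAB κ (tensorVacuum ψ))) =
      ∑' N, ∫ x, (‖ψ N x‖ ^ 2 : ℝ) * ∏ i, zFun (Real.cos κ ^ 2) (φ (x i)) (θ (x i))
        ∂timeMeasure t₀ t₁ N := by
  obtain ⟨g, hg⟩ := exists_eq_config hψ
  have h1 : Real.cos κ ^ 2 ≤ 1 := Real.cos_sq_le_one κ
  have h := tsum_overlap hψ hg (α := fun t => Complex.exp (Complex.I * φ t))
    (β := fun t => Complex.exp (-(Complex.I * θ t))) (by fun_prop) (by fun_prop)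
    (fun t => by simp [Complex.norm_exp]) (fun t => by simp [Complex.norm_exp])
    (sq_nonneg (Real.cos κ)) h1
  simp only [zFun, braket, conj_UB_mul_UA κ φ θ hg, integral_const_mul]
  rw [← h]
  refine tsum_congr fun p => ?_
  push_cast [overlap]
  rfl

/-- The overlap for `z` real and positive. -/
theorem ofReal_fidelity {t₀ t₁ κ η : ℝ} (hη : η = Real.cos κ ^ 2) {φ θ : ℝ → ℝ}
    (hφ : Measurable φ) (hθ : Measurable θ) {ψ : Field} (hψ : IsState t₀ t₁ ψ)
    (hz : ZPos t₀ t₁ η φ θ) :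
    ENNReal.ofReal (fidelity t₀ t₁ κ φ θ ψ) =
      (∑' N, ∫⁻ x, ‖ψ N x‖ₑ ^ 2 * ENNReal.ofReal (∏ i, (zFun η (φ (x i)) (θ (x i))).re)
        ∂timeMeasure t₀ t₁ N) ^ 2 := by
  have h0 : 0 ≤ η := hη ▸ sq_nonneg _
  have h1 : η ≤ 1 := hη ▸ Real.cos_sq_le_one κ
  let r : ℝ → ℝ := fun t => (zFun η (φ t) (θ t)).re
  have hr1 : ∀ t, r t ≤ 1 := fun t =>
    (Complex.re_le_norm _).trans (norm_zFun_le_one h0 h1 _ _)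
  have hrm : Measurable r := Complex.measurable_re.comp (measurable_zFun hφ hθ η)
  -- Positivity of `z` is known only on `[t₀, t₁]`, where almost every configuration has all its
  -- times.
  have hp0 : ∀ N, ∀ᵐ x ∂timeMeasure t₀ t₁ N, 0 ≤ ∏ i, r (x i) := fun N => by
    filter_upwards [ae_timeMeasure_mem t₀ t₁ N] with x hx
    exact Finset.prod_nonneg fun i _ => (hz _ (hx i)).2.le
  have hp1 : ∀ N, ∀ᵐ x ∂timeMeasure t₀ t₁ N, ∏ i, r (x i) ≤ 1 := fun N => by
    filter_upwards [ae_timeMeasure_mem t₀ t₁ N] with x hx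
    exact Finset.prod_le_one (fun i _ => (hz _ (hx i)).2.le) fun i _ => hr1 _
  have hpm : ∀ N, Measurable fun x : Fin N → ℝ => ∏ i, r (x i) := fun N => by fun_prop
  have hreal : ∀ N, ∫ x, (‖ψ N x‖ ^ 2 : ℝ) * ∏ i, zFun η (φ (x i)) (θ (x i))
      ∂timeMeasure t₀ t₁ N =
      ((∫ x, ‖ψ N x‖ ^ 2 * ∏ i, r (x i) ∂timeMeasure t₀ t₁ N : ℝ) : ℂ) := fun N => by
    rw [← integral_complex_ofReal]
    refine integral_congr_ae ?_
    filter_upwards [ae_timeMeasure_mem t₀ t₁ N] with x hx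
    rw [Complex.ofReal_mul, Complex.ofReal_prod]
    congr 1
    refine Finset.prod_congr rfl fun i _ => ?_
    exact Complex.ext rfl (hz _ (hx i)).1
  have hnn : ∀ N, 0 ≤ ∫ x, ‖ψ N x‖ ^ 2 * ∏ i, r (x i) ∂timeMeasure t₀ t₁ N := fun N =>
    integral_nonneg_of_ae <| (hp0 N).mono fun x hx => mul_nonneg (by positivity) hx
  have hle : ∀ N, ∫ x, ‖ψ N x‖ ^ 2 * ∏ i, r (x i) ∂timeMeasure t₀ t₁ N ≤
      ∫ x, ‖ψ N x‖ ^ 2 ∂timeMeasure t₀ t₁ N := fun N =>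
    integral_mono_of_nonneg ((hp0 N).mono fun x hx => mul_nonneg (by positivity) hx)
      (integrable_norm_sq hψ N) ((hp1 N).mono fun x hx => mul_le_of_le_one_right (by positivity) hx)
  have hs := Summable.of_nonneg_of_le hnn hle (summable_integral_norm_sq hψ)
  rw [fidelity, braket_eq hφ hθ hψ, ← hη]
  simp only [hreal]
  rw [← Complex.ofReal_tsum, Complex.norm_real, Real.norm_of_nonneg (tsum_nonneg hnn),
    ENNReal.ofReal_pow (tsum_nonneg hnn), ENNReal.ofReal_tsum_of_nonneg hnn hs]
  congr 1
  exact tsum_congr fun N => lintegral_norm_sq_mul hψ N (hpm N) (hp0 N) (hp1 N)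

/-! ### The mean flux as the density of photon times -/

theorem measurable_enorm_sq_cons {ψ : Field} (hψ : ∀ n, Measurable (ψ n)) (n : ℕ) :
    Measurable fun p : ℝ × (Fin n → ℝ) => ‖ψ (n + 1) (Fin.cons p.1 p.2)‖ₑ ^ 2 := by
  have : Measurable fun p : ℝ × (Fin n → ℝ) => (Fin.cons p.1 p.2 : Fin (n + 1) → ℝ) := by
    refine measurable_pi_iff.2 fun i => ?_
    refine Fin.cases (by simpa using measurable_fst) (fun j => ?_) i
    exact (measurable_pi_apply j).comp measurable_snd
  exact ((hψ (n + 1)).comp this).enorm.pow_const 2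

theorem measurable_enorm_sq_cons_right {ψ : Field} (hψ : ∀ n, Measurable (ψ n)) (n : ℕ) (t : ℝ) :
    Measurable fun s : Fin n → ℝ => ‖ψ (n + 1) (Fin.cons t s)‖ₑ ^ 2 := by
  have h := (measurable_enorm_sq_cons hψ n).comp (measurable_prodMk_left (x := t))
  simpa only [Function.comp_def] using h

theorem meanFlux_eq (t₀ t₁ : ℝ) {ψ : Field} (hψ : ∀ n, Measurable (ψ n)) (t : ℝ) :
    meanFlux t₀ t₁ ψ t = ∑' n : ℕ, ∫⁻ s, (n + 1) * ‖ψ (n + 1) (Fin.cons t s)‖ₑ ^ 2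
      ∂timeMeasure t₀ t₁ n := by
  rw [meanFlux, normSq, ENNReal.tsum_prod (f := fun n m => ∫⁻ x : (Fin n → ℝ) × (Fin m → ℝ),
    ‖annA t (tensorVacuum ψ) n m x.1 x.2‖ₑ ^ 2
      ∂((timeMeasure t₀ t₁ n).prod (timeMeasure t₀ t₁ m)))]
  refine tsum_congr fun n => ?_
  -- Field `B` is in the vacuum, so only `m = 0` contributes.
  rw [tsum_eq_single 0 fun m hm => by simp [annA, tensorVacuum, hm]]
  have h1 : ∀ s : Fin n → ℝ, ‖(Real.sqrt (n + 1) : ℂ) * ψ (n + 1) (Fin.cons t s)‖ₑ ^ 2 =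
      (n + 1) * ‖ψ (n + 1) (Fin.cons t s)‖ₑ ^ 2 := by
    intro s
    rw [enorm_mul, mul_pow, ← ofReal_norm (Real.sqrt (n + 1) : ℂ), Complex.norm_real,
      Real.norm_of_nonneg (Real.sqrt_nonneg _), ← ENNReal.ofReal_pow (Real.sqrt_nonneg _),
      Real.sq_sqrt (by positivity), ENNReal.ofReal_add (by positivity) (by positivity)]
    simp
  simp only [annA, tensorVacuum, if_true, h1]
  have hmeas : Measurable fun s : Fin n → ℝ =>
      (n + 1 : ℝ≥0∞) * ‖ψ (n + 1) (Fin.cons t s)‖ₑ ^ 2 :=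
    (measurable_enorm_sq_cons_right hψ n t).const_mul _
  have hmeas' : Measurable fun x : (Fin n → ℝ) × (Fin 0 → ℝ) =>
      (n + 1 : ℝ≥0∞) * ‖ψ (n + 1) (Fin.cons t x.1)‖ₑ ^ 2 := hmeas.comp measurable_fst
  rw [lintegral_prod _ hmeas'.aemeasurable]
  simp [timeMeasure]

/-- By exchange symmetry the photon `k` can be taken as the first one; Tonelli then isolates its
time. The result does not depend on `k`, so the sum over `k` yields the factor `n + 1` of the flux.
-/
theorem lintegral_norm_sq_mul_coord {t₀ t₁ : ℝ} {ψ : Field} (hψ : IsState t₀ t₁ ψ)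
    {h : ℝ → ℝ≥0∞} (hh : Measurable h) {n : ℕ} (k : Fin (n + 1)) :
    ∫⁻ x, ‖ψ (n + 1) x‖ₑ ^ 2 * h (x k) ∂timeMeasure t₀ t₁ (n + 1) =
      ∫⁻ t in Set.Icc t₀ t₁, (∫⁻ s, ‖ψ (n + 1) (Fin.cons t s)‖ₑ ^ 2
        ∂timeMeasure t₀ t₁ n) * h t := by
  obtain ⟨g, hg⟩ := exists_eq_config hψ
  have hmeas := measurable_enorm_sq_cons hψ.measurable n
  have hmp : MeasurePreserving (MeasurableEquiv.piFinSuccAbove (fun _ => ℝ) k)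
      (timeMeasure t₀ t₁ (n + 1))
      ((volume.restrict (Set.Icc t₀ t₁)).prod (timeMeasure t₀ t₁ n)) :=
    measurePreserving_piFinSuccAbove (fun _ => volume.restrict (Set.Icc t₀ t₁)) k
  let F : ℝ × (Fin n → ℝ) → ℝ≥0∞ := fun p => ‖ψ (n + 1) (Fin.cons p.1 p.2)‖ₑ ^ 2 * h p.1
  have hF : Measurable F := hmeas.mul (hh.comp measurable_fst)
  have hx : ∀ x : Fin (n + 1) → ℝ, ‖ψ (n + 1) x‖ₑ ^ 2 * h (x k) =
      F (MeasurableEquiv.piFinSuccAbove (fun _ => ℝ) k x) := fun x => by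
    have : ψ (n + 1) x = ψ (n + 1) (Fin.cons (x k) (k.removeNth x)) := by
      rw [hg, hg, config_cons_removeNth]
    rw [this]
    rfl
  rw [lintegral_congr hx, hmp.lintegral_comp hF, lintegral_prod _ hF.aemeasurable]
  refine lintegral_congr fun t => ?_
  simp only [F]
  exact lintegral_mul_const _ (measurable_enorm_sq_cons_right hψ.measurable n t)

theorem lintegral_norm_sq_mul_sum {t₀ t₁ : ℝ} {ψ : Field} (hψ : IsState t₀ t₁ ψ)
    {h : ℝ → ℝ≥0∞} (hh : Measurable h) (n : ℕ) :
    ∫⁻ x, ‖ψ (n + 1) x‖ₑ ^ 2 * ∑ k, h (x k) ∂timeMeasure t₀ t₁ (n + 1) =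
      ∫⁻ t in Set.Icc t₀ t₁, (∫⁻ s, (n + 1) * ‖ψ (n + 1) (Fin.cons t s)‖ₑ ^ 2
        ∂timeMeasure t₀ t₁ n) * h t := by
  have hmeas := measurable_enorm_sq_cons hψ.measurable n
  have hint : Measurable fun t =>
      (∫⁻ s, ‖ψ (n + 1) (Fin.cons t s)‖ₑ ^ 2 ∂timeMeasure t₀ t₁ n) * h t :=
    hmeas.lintegral_prod_right'.mul hh
  have hterm : ∀ k : Fin (n + 1), Measurable fun x : Fin (n + 1) → ℝ =>
      ‖ψ (n + 1) x‖ₑ ^ 2 * h (x k) := fun k =>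
    ((hψ.measurable _).enorm.pow_const 2).mul (hh.comp (measurable_pi_apply k))
  simp only [Finset.mul_sum]
  rw [lintegral_finsetSum _ fun k _ => hterm k]
  simp only [lintegral_norm_sq_mul_coord hψ hh, Finset.sum_const, Finset.card_univ,
    Fintype.card_fin, nsmul_eq_mul]
  rw [← lintegral_const_mul _ hint]
  refine lintegral_congr fun t => ?_
  have : ∫⁻ s, (n + 1) * ‖ψ (n + 1) (Fin.cons t s)‖ₑ ^ 2 ∂timeMeasure t₀ t₁ n =
      (n + 1) * ∫⁻ s, ‖ψ (n + 1) (Fin.cons t s)‖ₑ ^ 2 ∂timeMeasure t₀ t₁ n :=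
    lintegral_const_mul _ (measurable_enorm_sq_cons_right hψ.measurable n t)
  rw [this, Nat.cast_succ, mul_assoc]

/-- The flux weighted by `h` counts `h` at all photon times. -/
theorem lintegral_meanFlux_mul {t₀ t₁ : ℝ} {ψ : Field} (hψ : IsState t₀ t₁ ψ) {h : ℝ → ℝ≥0∞}
    (hh : Measurable h) :
    ∫⁻ t in Set.Icc t₀ t₁, meanFlux t₀ t₁ ψ t * h t =
      ∑' N, ∫⁻ x, ‖ψ N x‖ₑ ^ 2 * ∑ k, h (x k) ∂timeMeasure t₀ t₁ N := by
  have hint : ∀ n : ℕ, Measurable fun t =>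
      (∫⁻ s, (n + 1) * ‖ψ (n + 1) (Fin.cons t s)‖ₑ ^ 2 ∂timeMeasure t₀ t₁ n) * h t := fun n =>
    (((measurable_enorm_sq_cons hψ.measurable n).const_mul (n + 1 : ℝ≥0∞)).lintegral_prod_right').mul
      hh
  -- The term `N = 0` vanishes, its sum over photons being empty; the others match the flux with
  -- index shifted by one.
  rw [tsum_eq_zero_add' ENNReal.summable]
  simp only [meanFlux_eq t₀ t₁ hψ.measurable, ← ENNReal.tsum_mul_right,
    lintegral_norm_sq_mul_sum hψ hh]
  rw [lintegral_tsum fun n => (hint n).aemeasurable]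
  simp

/-! ### Jensen's inequality -/

/-- The tangent line bound behind Jensen's inequality. -/
theorem jensen_bound {n : ℕ} {r : Fin n → ℝ} (h0 : ∀ i, 0 < r i) (h1 : ∀ i, r i ≤ 1) (c : ℝ) :
    ENNReal.ofReal (Real.exp (-c) * (1 + c)) ≤ ENNReal.ofReal (∏ i, r i) +
      ENNReal.ofReal (Real.exp (-c) / 2) * ∑ i, ENNReal.ofReal (-Real.log (r i ^ 2)) := by
  have hl : ∀ i, 0 ≤ -Real.log (r i ^ 2) := fun i =>
    neg_nonneg.2 (Real.log_nonpos (sq_nonneg _) (pow_le_one₀ (h0 i).le (h1 i)))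
  have hs : 0 ≤ ∑ i, -Real.log (r i ^ 2) := Finset.sum_nonneg fun i _ => hl i
  rw [← ENNReal.ofReal_sum_of_nonneg fun i _ => hl i, ← ENNReal.ofReal_mul (by positivity),
    ← ENNReal.ofReal_add (Finset.prod_nonneg fun i _ => (h0 i).le) (by positivity)]
  refine ENNReal.ofReal_le_ofReal ?_
  have hy : ∑ i, -Real.log (r i ^ 2) = -2 * ∑ i, Real.log (r i) := by
    rw [Finset.mul_sum]
    refine Finset.sum_congr rfl fun i _ => ?_
    rw [Real.log_pow]
    push_cast
    ring
  have hp : ∏ i, r i = Real.exp (-c) * Real.exp (c + ∑ i, Real.log (r i)) := by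
    rw [← Real.exp_add, neg_add_cancel_left, Real.exp_sum]
    exact Finset.prod_congr rfl fun i _ => (Real.exp_log (h0 i)).symm
  rw [hy, hp]
  -- The tangent to `exp` at `-c`, evaluated at `∑ log rᵢ`. The factor `1/2` in the statement
  -- compensates `log r² = 2 log r`.
  have := mul_le_mul_of_nonneg_left (Real.add_one_le_exp (c + ∑ i, Real.log (r i)))
    (Real.exp_pos (-c)).le
  linarith

theorem fidelity_bound {t₀ t₁ κ η : ℝ} (hη : η = Real.cos κ ^ 2) {φ θ : ℝ → ℝ}
    (hφ : Measurable φ) (hθ : Measurable θ) {ψ : Field} (hψ : IsState t₀ t₁ ψ)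
    (hz : ZPos t₀ t₁ η φ θ) :
    EReal.exp (fluxLogIntegral t₀ t₁ η φ θ ψ) ≤ ENNReal.ofReal (fidelity t₀ t₁ κ φ θ ψ) := by
  have h0 : 0 ≤ η := hη ▸ sq_nonneg _
  have h1 : η ≤ 1 := hη ▸ Real.cos_sq_le_one κ
  have hrm : Measurable fun t => (zFun η (φ t) (θ t)).re :=
    Complex.measurable_re.comp (measurable_zFun hφ hθ η)
  rw [ofReal_fidelity hη hφ hθ hψ hz, fluxLogIntegral, lintegral_meanFlux_mul hψ (by fun_prop)]
  set A := ∑' N, ∫⁻ x, ‖ψ N x‖ₑ ^ 2 * ∑ k, ENNReal.ofReal (-Real.log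
    ((zFun η (φ (x k)) (θ (x k))).re ^ 2)) ∂timeMeasure t₀ t₁ N with hA
  set R := ∑' N, ∫⁻ x, ‖ψ N x‖ₑ ^ 2 * ENNReal.ofReal (∏ i, (zFun η (φ (x i)) (θ (x i))).re)
    ∂timeMeasure t₀ t₁ N with hR
  -- For an infinite integral the lower bound is `exp (-∞) = 0`.
  rcases eq_or_ne A ⊤ with htop | htop
  · simp [htop]
  -- `-c` is the mean of `∑ ln z(tᵢ)`, the point at which the tangent is optimal.
  obtain ⟨c, hc, hAc⟩ : ∃ c : ℝ, 0 ≤ c ∧ A = ENNReal.ofReal (2 * c) :=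
    ⟨A.toReal / 2, by positivity, by rw [mul_div_cancel₀ _ two_ne_zero, ENNReal.ofReal_toReal htop]⟩
  have hkey : ENNReal.ofReal (Real.exp (-c) * (1 + c)) ≤
      R + ENNReal.ofReal (Real.exp (-c) / 2) * A := by
    have hm : ∀ N, Measurable fun x => ‖ψ N x‖ₑ ^ 2 := fun N =>
      (hψ.measurable N).enorm.pow_const 2
    -- Writing `1` as the total probability `∑ ∫ |ψ_N|²` reduces the claim to the pointwise tangent
    -- bound.
    rw [← one_mul (ENNReal.ofReal _), ← hψ.norm_eq_one, ← ENNReal.tsum_mul_right, hA, hR,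
      ← ENNReal.tsum_mul_left, ← ENNReal.tsum_add]
    refine ENNReal.tsum_le_tsum fun N => ?_
    rw [← lintegral_const_mul _ (by fun_prop), ← lintegral_mul_const _ (by fun_prop),
      ← lintegral_add_left (by fun_prop)]
    refine lintegral_mono_ae ?_
    filter_upwards [ae_timeMeasure_mem t₀ t₁ N] with x hx
    refine (mul_le_mul_right (jensen_bound (r := fun i => (zFun η (φ (x i)) (θ (x i))).re)
      (fun i => (hz _ (hx i)).2)
      (fun i => (Complex.re_le_norm _).trans (norm_zFun_le_one h0 h1 _ _)) c) _).trans ?_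
    rw [mul_add]
    refine le_of_eq ?_
    ring
  -- With `A = 2c` the linear correction is exactly `e^{-c} c` and cancels.
  have hRc : ENNReal.ofReal (Real.exp (-c)) ≤ R := by
    rw [hAc, ← ENNReal.ofReal_mul (by positivity), mul_add, mul_one,
      ENNReal.ofReal_add (by positivity) (by positivity),
      show Real.exp (-c) / 2 * (2 * c) = Real.exp (-c) * c by ring] at hkey
    exact (ENNReal.add_le_add_iff_right ENNReal.ofReal_ne_top).1 hkey
  rw [hAc, EReal.coe_ennreal_ofReal, max_eq_left (by positivity), ← EReal.coe_neg, EReal.exp_coe]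
  calc ENNReal.ofReal (Real.exp (-(2 * c))) = ENNReal.ofReal (Real.exp (-c)) ^ 2 := by
        rw [← ENNReal.ofReal_pow (Real.exp_pos _).le, ← Real.exp_nat_mul]
        congr 2
        push_cast
        ring
    _ ≤ R ^ 2 := by gcongr

/-! ### Existence of the compensating phase -/

theorem zFun_re (η φ θ : ℝ) : (zFun η φ θ).re = η * Real.cos φ + (1 - η) * Real.cos θ := by
  simp [zFun, Complex.exp_re]

theorem zFun_im (η φ θ : ℝ) : (zFun η φ θ).im = η * Real.sin φ - (1 - η) * Real.sin θ := by
  simp [zFun, Complex.exp_im]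
  ring

theorem zFun_arcsin {η φ : ℝ} (h0 : 0 ≤ η) (h1 : η ≤ 1) (h : PhaseCondition η φ) :
    (zFun η φ (Real.arcsin (η * Real.sin φ / (1 - η)))).im = 0 ∧
      0 < (zFun η φ (Real.arcsin (η * Real.sin φ / (1 - η)))).re := by
  set y := η * Real.sin φ / (1 - η) with hy
  have habs : |y| ≤ 1 ∧ η * Real.sin φ = (1 - η) * y := by
    -- At `η = 1` condition (II) forces `sin φ = 0`, and the quotient with denominator `0` is `0`.
    rcases h1.eq_or_lt with rfl | h1
    · have h2 := h.resolve_left (by norm_num)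
      have h3 : Real.sin φ = 0 := by simpa using h2.2.1
      simp [hy, h3]
    · have hpos : 0 < 1 - η := by linarith
      refine ⟨?_, by rw [hy]; field_simp⟩
      rw [hy, abs_div, abs_of_pos hpos, div_le_one hpos, abs_mul, abs_of_nonneg h0]
      rcases h with h | ⟨h2, h3, -⟩
      · nlinarith [Real.abs_sin_le_one φ]
      · rw [le_div_iff₀ (by linarith)] at h3
        linarith
  have hy1 := abs_le.1 habs.1
  rw [zFun_re, zFun_im, Real.sin_arcsin hy1.1 hy1.2]
  refine ⟨by linarith [habs.2], ?_⟩
  have hc := Real.cos_arcsin_nonneg y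
  rcases h with h | ⟨h2, -, h4⟩
  · have h5 : Real.cos (Real.arcsin y) ^ 2 = 1 - y ^ 2 := by
      rw [Real.cos_sq', Real.sin_arcsin hy1.1 hy1.2]
    -- As `η sin φ = (1 - η) y`, the squares differ by `(1 - η)² - η²`, positive for `η < 1/2`; so
    -- the nonnegative term `(1 - η) cos θ` outweighs `η cos φ`.
    have h6 : (η * Real.cos φ) ^ 2 < ((1 - η) * Real.cos (Real.arcsin y)) ^ 2 := by
      rw [mul_pow, mul_pow, h5, Real.cos_sq']
      have h7 : η ^ 2 * Real.sin φ ^ 2 = (1 - η) ^ 2 * y ^ 2 := by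
        rw [← mul_pow, ← mul_pow, habs.2]
      nlinarith
    have h8 := abs_lt_of_sq_lt_sq h6 (mul_nonneg (by linarith) hc)
    linarith [(abs_lt.1 h8).1]
  · have : 0 < η * Real.cos φ := mul_pos (by linarith) h4
    have := mul_nonneg (by linarith : 0 ≤ 1 - η) hc
    linarith

end LossyPhase

end

theorem mainTheorem5 (t₀ t₁ : ℝ) (ht : t₀ ≤ t₁) (κ η : ℝ) (hη : η = Real.cos κ ^ 2)
    (φ : ℝ → ℝ) (hφ : Measurable φ)
    (hcond : ∀ t ∈ Set.Icc t₀ t₁, LossyPhase.PhaseCondition η (φ t))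
    (ψ : LossyPhase.Field) (hψ : LossyPhase.IsState t₀ t₁ ψ) :
    (∃ θ : ℝ → ℝ, Measurable θ ∧ LossyPhase.ZPos t₀ t₁ η φ θ) ∧
    ∀ θ : ℝ → ℝ, Measurable θ → LossyPhase.ZPos t₀ t₁ η φ θ →
      EReal.exp (LossyPhase.fluxLogIntegral t₀ t₁ η φ θ ψ) ≤
        ENNReal.ofReal (LossyPhase.fidelity t₀ t₁ κ φ θ ψ) := by
  refine ⟨⟨fun t => Real.arcsin (η * Real.sin (φ t) / (1 - η)), ?_, fun t ht => ?_⟩,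
    fun θ hθ hz => LossyPhase.fidelity_bound hη hφ hθ hψ hz⟩
  · exact Real.continuous_arcsin.measurable.comp (by fun_prop)
  · exact LossyPhase.zFun_arcsin (hη ▸ sq_nonneg _) (hη ▸ Real.cos_sq_le_one κ) (hcond t ht)
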